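/- There exist $n\in\mathbb N$, an action of the free group $\mathbb F_n$ on $n$ generators on a Polish space $X$ by Borel automorphisms (i.e. for every $\gamma\in\mathbb F_n$ the map $x\mapsto\gamma\cdot x$ is Borel), and Borel sets $B_0,B_1\subseteq X$ such that $B_0$ and $B_1$ are equidecomposable, but not equidecomposable using pieces with the Baire property. Here $A,B\subseteq X$ are equidecomposable if there are a partition of $A$ into finitely many sets (pieces) $A_1,\dots,A_k$ and elements $\alpha_1,\dots,\alpha_k\in\mathbb F_n$ such that the sets $\alpha_iA_i$ are pairwise disjoint and $B=\alpha_1A_1\cup\dots\cup\alpha_kA_k$; they are equidecomposable using pieces with the Baire property if, in addition, the $A_i$ can be chosen with the Baire property. -/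

import Mathlib

/-- `A` and `B` are equidecomposable with respect to the action of `Γ` on `X`, using pieces that
satisfy `p`: there are a partition of `A` into finitely many sets `P i`, each satisfying `p`, and
group elements `γ i` such that the translates `γ i • P i` partition `B`.
(Some pieces may be empty.) -/
def EquidecomposableUsing (Γ : Type*) {X : Type*} [Group Γ] [MulAction Γ X]
    (p : Set X → Prop) (A B : Set X) : Prop :=
  ∃ (k : ℕ) (P : Fin k → Set X) (γ : Fin k → Γ),
    (∀ i, p (P i)) ∧
    (∀ i j, i ≠ j → Disjoint (P i) (P j)) ∧
    (⋃ i, P i) = A ∧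
    (∀ i j, i ≠ j → Disjoint ((fun x => γ i • x) '' P i) ((fun x => γ j • x) '' P j)) ∧
    (⋃ i, (fun x => γ i • x) '' P i) = B

/-- Equidecomposability with arbitrary pieces. -/
def Equidecomposable (Γ : Type*) {X : Type*} [Group Γ] [MulAction Γ X] (A B : Set X) : Prop :=
  EquidecomposableUsing Γ (fun _ => True) A B

/-- A group acts by Borel automorphisms if every `x ↦ γ • x` is Borel. -/
def ActsByBorelAutomorphisms (Γ X : Type*) [TopologicalSpace X] [MeasurableSpace X] [BorelSpace X]
    [Group Γ] [MulAction Γ X] : Prop :=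
  ∀ γ : Γ, Measurable (fun x : X => γ • x)

/-! Up to reflection, colorings form a graph: crossing a colored edge moves the origin to a
neighbor, and two colors are available at each vertex. Changing copy at each crossing gives a
bipartite double cover with sides `B₀` and `B₁`, where `ascending` picks one orientation of each
coloring. Counted with colors the graph is 2-regular, so Hall's theorem and Schröder–Bernstein give
a perfect matching, which is an equidecomposition (`equidecomposable_ascending`).

Pieces with the Baire property would give a bounded Baire measurable displacement, odd because the
copy changes (`exists_isOddMatching`). On a generic line, which has no symmetry, it maps the even
vertices bijectively onto the odd ones. Their net flow to the right grows by 1 past an even vertex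
and drops by 1 past an odd one, so it has the same value `F` at the left of every even vertex.
Reflection in an even vertex turns `F` into `-1 - F`, so the sign of `F` orients the line. This
orientation is invariant under even shifts, has the Baire property and is reversed by reflection,
against the topological transitivity of even shifts (`not_isOddMatching`). -/

/-- Proper edge colorings, with three colors, of the bi-infinite line. The edge `k` joins the
vertices `k` and `k + 1`. -/
abbrev LineColoring : Type := {w : ℤ → Fin 3 // ∀ k, w k ≠ w (k + 1)}

/-! ### Shifts and reflections of line colorings -/

namespace LineColoring

/-- Moves the origin of a line coloring by `n`. -/
def shift (n : ℤ) (w : LineColoring) : LineColoring :=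
  ⟨fun k => w.1 (k + n), fun k => by
    have := w.2 (k + n)
    rwa [show k + n + 1 = k + 1 + n by ring] at this⟩

/-- Reflects a line coloring in the vertex `0`. -/
def flip (w : LineColoring) : LineColoring :=
  ⟨fun k => w.1 (-1 - k), fun k => by
    have := w.2 (-1 - (k + 1))
    rw [show -1 - (k + 1) + 1 = -1 - k by ring] at this
    exact this.symm⟩

@[simp] theorem shift_apply (n : ℤ) (w : LineColoring) (k : ℤ) : (shift n w).1 k = w.1 (k + n) :=
  rfl

@[simp] theorem flip_apply (w : LineColoring) (k : ℤ) : (flip w).1 k = w.1 (-1 - k) := rfl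

@[simp] theorem shift_zero (w : LineColoring) : shift 0 w = w := by
  ext k; simp

@[simp] theorem shift_shift (m n : ℤ) (w : LineColoring) :
    shift m (shift n w) = shift (m + n) w := by
  ext k; simp [add_assoc]

@[simp] theorem flip_flip (w : LineColoring) : flip (flip w) = w := by
  ext k; simp

theorem flip_shift (n : ℤ) (w : LineColoring) : flip (shift n w) = shift (-n) (flip w) := by
  ext k; simp only [flip_apply, shift_apply]; ring_nf

theorem shift_flip (n : ℤ) (w : LineColoring) : shift n (flip w) = flip (shift (-n) w) := by
  rw [flip_shift, neg_neg]

theorem continuous_eval (k : ℤ) : Continuous fun w : LineColoring => w.1 k :=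
  (continuous_apply k).comp continuous_subtype_val

theorem continuous_shift (n : ℤ) : Continuous (shift n) := by
  exact Continuous.subtype_mk (continuous_pi fun k => continuous_eval (k + n)) _

theorem continuous_flip : Continuous flip := by
  exact Continuous.subtype_mk (continuous_pi fun k => continuous_eval (-1 - k)) _

theorem continuous_shift_comp {n : LineColoring → ℤ} (hn : Continuous n) :
    Continuous fun w => shift (n w) w := by
  refine continuous_iff_continuousAt.2 fun w => ?_
  have h : ∀ᶠ v in nhds w, n v = n w :=
    hn.continuousAt.eventually (IsOpen.mem_nhds (isOpen_discrete {n w}) rfl)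
  exact (continuous_shift (n w)).continuousAt.congr (h.mono fun v hv => by simp only [hv])

/-- `LineColoring.shift` as a homeomorphism. -/
def shiftHomeomorph (n : ℤ) : LineColoring ≃ₜ LineColoring where
  toFun := shift n
  invFun := shift (-n)
  left_inv w := by simp
  right_inv w := by simp
  continuous_toFun := continuous_shift n
  continuous_invFun := continuous_shift (-n)

/-- `LineColoring.flip` as a homeomorphism. -/
def flipHomeomorph : LineColoring ≃ₜ LineColoring where
  toFun := flip
  invFun := flip
  left_inv := flip_flip
  right_inv := flip_flip
  continuous_toFun := continuous_flip
  continuous_invFun := continuous_flip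

theorem isClosed_setOf_proper : IsClosed {w : ℤ → Fin 3 | ∀ k, w k ≠ w (k + 1)} := by
  simp only [Set.ofPred_forall]
  refine isClosed_iInter fun k => ?_
  exact (isClosed_discrete {p : Fin 3 × Fin 3 | p.1 ≠ p.2}).preimage
    (f := fun w : ℤ → Fin 3 => (w k, w (k + 1))) (by fun_prop)

instance : PolishSpace LineColoring :=
  have : PolishSpace (ℤ → Fin 3) :=
    { toSecondCountableTopology := inferInstance, toIsCompletelyMetrizableSpace := inferInstance }
  isClosed_setOf_proper.polishSpace

theorem ne_left (w : LineColoring) : w.1 (-1) ≠ w.1 0 := w.2 (-1)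

/-! ### Edge crossings and orientations -/

/-- The displacement, along the edge of color `c`, of the vertex `0`. -/
def step (c : Fin 3) (w : LineColoring) : ℤ :=
  if w.1 0 = c then 1 else if w.1 (-1) = c then -1 else 0

theorem step_flip (c : Fin 3) (w : LineColoring) : step c (flip w) = -step c w := by
  have := ne_left w
  simp only [step, flip_apply]
  norm_num
  split_ifs <;> simp_all

theorem step_shift_step (c : Fin 3) (w : LineColoring) :
    step c (shift (step c w) w) = -step c w := by
  have h₁ := w.2 (-1)
  have h₂ := w.2 0
  have h₃ := w.2 (-2)
  norm_num at h₁ h₂ h₃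
  unfold step
  split_ifs <;> simp_all

theorem continuous_step (c : Fin 3) : Continuous (step c) :=
  (continuous_of_discreteTopology
    (f := fun p : Fin 3 × Fin 3 => if p.1 = c then (1 : ℤ) else if p.2 = c then -1 else 0)).comp
    ((continuous_eval 0).prodMk (continuous_eval (-1)))

/-- Crosses the edge of color `c` at the vertex `0`, if there is one. -/
def cross (c : Fin 3) (w : LineColoring) : LineColoring := shift (step c w) w

theorem cross_cross (c : Fin 3) (w : LineColoring) : cross c (cross c w) = w := by
  simp only [cross, step_shift_step, shift_shift, neg_add_cancel, shift_zero]

theorem cross_flip (c : Fin 3) (w : LineColoring) : cross c (flip w) = flip (cross c w) := by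
  simp only [cross, step_flip, flip_shift]

/-- The colorings in which the color at the right of the vertex `0` is the larger one. -/
def ascending : Set LineColoring := {w | w.1 (-1) < w.1 0}

theorem isClopen_ascending : IsClopen ascending :=
  (isClopen_discrete {p : Fin 3 × Fin 3 | p.1 < p.2}).preimage
    ((continuous_eval (-1)).prodMk (continuous_eval 0))

theorem flip_mem_ascending_iff {w : LineColoring} : flip w ∈ ascending ↔ w ∉ ascending := by
  have := ne_left w
  simp only [ascending, Set.mem_ofPred_eq, flip_apply]
  norm_num
  exact ⟨le_of_lt, fun h => lt_of_le_of_ne h this.symm⟩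

open Classical in
/-- The one of `w` and `flip w` that is ascending. -/
noncomputable def normalize (w : LineColoring) : LineColoring :=
  if w ∈ ascending then w else flip w

theorem normalize_of_mem {w : LineColoring} (h : w ∈ ascending) : normalize w = w := if_pos h

theorem normalize_of_notMem {w : LineColoring} (h : w ∉ ascending) : normalize w = flip w :=
  if_neg h

theorem normalize_mem (w : LineColoring) : normalize w ∈ ascending := by
  by_cases h : w ∈ ascending
  · rwa [normalize_of_mem h]
  · rwa [normalize_of_notMem h, flip_mem_ascending_iff]

theorem normalize_eq_or (w : LineColoring) : normalize w = w ∨ normalize w = flip w := by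
  by_cases h : w ∈ ascending
  · exact .inl (normalize_of_mem h)
  · exact .inr (normalize_of_notMem h)

theorem normalize_flip (w : LineColoring) : normalize (flip w) = normalize w := by
  by_cases h : w ∈ ascending
  · rw [normalize_of_mem h, normalize_of_notMem (by simpa [flip_mem_ascending_iff]), flip_flip]
  · rw [normalize_of_notMem h, normalize_of_mem (flip_mem_ascending_iff.2 h)]

theorem eq_or_eq_flip_of_normalize_eq {v w : LineColoring} (h : normalize v = normalize w) :
    v = w ∨ v = flip w := by
  rcases normalize_eq_or v with hv | hv <;> rcases normalize_eq_or w with hw | hw <;>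
    rw [hv, hw] at h
  · exact .inl h
  · exact .inr h
  · exact .inr (by rw [← h, flip_flip])
  · exact .inl (by rw [← flip_flip v, h, flip_flip])

/-! ### The free group action -/

/-- The action of the generators of the free group on four generators: the first three cross the
edge of the given color, and move to the other one of two copies of the space; the last one
reflects the line. -/
def gen (i : Fin 4) (x : LineColoring × Bool) : LineColoring × Bool :=
  if h : (i : ℕ) < 3 then (cross ⟨i, h⟩ x.1, xor x.2 (step ⟨i, h⟩ x.1).bodd) else (flip x.1, x.2)

theorem gen_castSucc (c : Fin 3) (x : LineColoring × Bool) :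
    gen c.castSucc x = (cross c x.1, xor x.2 (step c x.1).bodd) := by
  simp [gen]

theorem gen_last (x : LineColoring × Bool) : gen (Fin.last 3) x = (flip x.1, x.2) := by
  simp [gen]

theorem gen_involutive (i : Fin 4) : Function.Involutive (gen i) := by
  rintro ⟨w, b⟩
  induction i using Fin.lastCases with
  | last => rw [gen_last, gen_last, flip_flip]
  | cast c =>
    simp only [gen_castSucc, cross_cross]
    simp [cross, step_shift_step, Int.bodd_neg]

theorem continuous_gen (i : Fin 4) : Continuous (gen i) := by
  induction i using Fin.lastCases with
  | last =>
    rw [funext gen_last]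
    exact (continuous_flip.comp continuous_fst).prodMk continuous_snd
  | cast c =>
    rw [funext (gen_castSucc c)]
    exact ((continuous_shift_comp (continuous_step c)).comp continuous_fst).prodMk
      ((continuous_of_discreteTopology (f := fun p : Bool × ℤ => xor p.1 p.2.bodd)).comp
        (continuous_snd.prodMk ((continuous_step c).comp continuous_fst)))

/-- The action of the free group on four generators on two copies of the space of colorings. -/
instance : MulAction (FreeGroup (Fin 4)) (LineColoring × Bool) :=
  MulAction.compHom _ (FreeGroup.lift fun i => (gen_involutive i).toPerm)

theorem of_smul (i : Fin 4) (x : LineColoring × Bool) : FreeGroup.of i • x = gen i x := by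
  change (FreeGroup.lift fun i => (gen_involutive i).toPerm) (FreeGroup.of i) x = _
  simp

theorem of_inv_smul (i : Fin 4) (x : LineColoring × Bool) : (FreeGroup.of i)⁻¹ • x = gen i x := by
  rw [inv_smul_eq_iff, of_smul, gen_involutive]

theorem continuous_smul_freeGroup (γ : FreeGroup (Fin 4)) :
    Continuous fun x : LineColoring × Bool => γ • x := by
  induction γ using FreeGroup.induction_on with
  | C1 => simp only [one_smul]; exact continuous_id
  | of i => simpa only [of_smul] using continuous_gen i
  | inv_of i _ => simpa only [of_inv_smul] using continuous_gen i
  | mul γ δ hγ hδ => simp only [mul_smul]; exact Continuous.comp (g := fun x : LineColoring × Bool => γ • x) hγ hδ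

/-! ### A perfect matching by Hall's theorem -/

/-- Crossing an edge, on the space of ascending colorings. -/
noncomputable def crossAscending (c : Fin 3) (w : ascending) : ascending :=
  ⟨normalize (cross c w.1), normalize_mem _⟩

theorem crossAscending_involutive (c : Fin 3) : Function.Involutive (crossAscending c) := by
  rintro ⟨w, hw⟩
  ext1
  simp only [crossAscending]
  rcases normalize_eq_or (cross c w) with h | h <;> rw [h]
  · rw [cross_cross, normalize_of_mem hw]
  · rw [cross_flip, cross_cross, normalize_flip, normalize_of_mem hw]

/-- The two colors at the vertex `0`. -/
def colors (w : LineColoring) : Finset (Fin 3) := {w.1 (-1), w.1 0}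

theorem card_colors (w : LineColoring) : (colors w).card = 2 := Finset.card_pair (ne_left w)

theorem colors_flip (w : LineColoring) : colors (flip w) = colors w := by
  simp [colors, Finset.pair_comm]

theorem colors_normalize (w : LineColoring) : colors (normalize w) = colors w := by
  rcases normalize_eq_or w with h | h <;> simp [h, colors_flip]

theorem step_ne_zero_iff {c : Fin 3} {w : LineColoring} : step c w ≠ 0 ↔ c ∈ colors w := by
  unfold step colors
  split_ifs <;> simp_all [eq_comm]

theorem bodd_step {c : Fin 3} {w : LineColoring} (h : c ∈ colors w) : (step c w).bodd = true := by
  rw [← step_ne_zero_iff] at h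
  unfold step at h ⊢
  split_ifs at h ⊢ <;> simp_all [Int.bodd_neg]

theorem mem_colors_crossAscending {c : Fin 3} {w : ascending} (h : c ∈ colors w.1) :
    c ∈ colors (crossAscending c w).1 := by
  rw [crossAscending, colors_normalize, ← step_ne_zero_iff, cross, step_shift_step, neg_ne_zero,
    step_ne_zero_iff]
  exact h

open Classical in
theorem exists_injective_crossAscending :
    ∃ e : ascending → ascending, Function.Injective e ∧
      ∀ w, ∃ c ∈ colors w.1, e w = crossAscending c w := by
  let t (w : ascending) : Finset ascending := (colors w.1).image fun c => crossAscending c w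
  obtain ⟨e, he, het⟩ := (Finset.all_card_le_biUnion_card_iff_exists_injective t).1 (by
    intro s
    -- Double counting of pairs (vertex, color at it). Keeping the color makes crossing injective
    -- even where both colors lead to the same vertex.
    have key : (s.sigma fun w => colors w.1).card ≤
        ((s.biUnion t).sigma fun w => colors w.1).card := by
      refine Finset.card_le_card_of_injOn (fun p => ⟨crossAscending p.2 p.1, p.2⟩) ?_ ?_
      · rintro ⟨w, c⟩ h
        simp only [Finset.coe_sigma, Set.mem_sigma_iff, Finset.mem_coe] at h ⊢
        exact ⟨Finset.mem_biUnion.2 ⟨w, h.1, Finset.mem_image_of_mem _ h.2⟩,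
          mem_colors_crossAscending h.2⟩
      · rintro ⟨w, c⟩ - ⟨w', c'⟩ - h
        simp only [Sigma.mk.injEq, heq_eq_eq] at h
        obtain ⟨h, rfl⟩ := h
        rw [(crossAscending_involutive c).injective h]
    simp only [Finset.card_sigma, card_colors, Finset.sum_const, smul_eq_mul] at key
    omega)
  refine ⟨e, he, fun w => ?_⟩
  obtain ⟨c, hc, h⟩ := Finset.mem_image.1 (het w)
  exact ⟨c, hc, h.symm⟩

/-- Crossing is an involution, so adjacency is symmetric and the same injection serves
Schröder–Bernstein in both directions. -/
theorem exists_bijective_crossAscending :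
    ∃ e : ascending → ascending, Function.Bijective e ∧
      ∀ w, ∃ c ∈ colors w.1, e w = crossAscending c w := by
  obtain ⟨e, he, hc⟩ := exists_injective_crossAscending
  refine Function.Embedding.schroeder_bernstein_of_rel he he
    (fun v w => ∃ c ∈ colors v.1, w = crossAscending c v) hc fun w => ?_
  obtain ⟨c, h, h'⟩ := hc w
  exact ⟨c, h' ▸ mem_colors_crossAscending h, by rw [h', crossAscending_involutive c w]⟩

end LineColoring

/-- A bijection that acts at every point as one of finitely many group elements gives an
equidecomposition. -/
theorem Equidecomposable.of_bijOn {Γ X : Type*} [Group Γ] [MulAction Γ X] {A B : Set X}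
    {f : X → X} (hf : Set.BijOn f A B) (s : Finset Γ) (hs : ∀ x ∈ A, ∃ γ ∈ s, f x = γ • x) :
    Equidecomposable Γ A B := by
  classical
  choose! g hgs hg using hs
  have himage (i : Fin s.card) :
      (fun x => (s.equivFin.symm i : Γ) • x) '' {x ∈ A | g x = s.equivFin.symm i} =
        f '' {x ∈ A | g x = s.equivFin.symm i} :=
    Set.image_congr fun x hx => by rw [hg x hx.1, hx.2]
  have hdisj (i j : Fin s.card) (hij : i ≠ j) :
      Disjoint {x ∈ A | g x = s.equivFin.symm i} {x ∈ A | g x = s.equivFin.symm j} :=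
    Set.disjoint_left.2 fun x hx hx' =>
      hij (s.equivFin.symm.injective (Subtype.ext (hx.2.symm.trans hx'.2)))
  have hunion : ⋃ i, {x ∈ A | g x = s.equivFin.symm i} = A := by
    ext x
    simp only [Set.mem_iUnion]
    exact ⟨fun ⟨_, h⟩ => h.1, fun h => ⟨s.equivFin ⟨g x, hgs x h⟩, h, by simp⟩⟩
  refine ⟨s.card, fun i => {x ∈ A | g x = s.equivFin.symm i}, fun i => s.equivFin.symm i,
    fun _ => trivial, hdisj, hunion, fun i j hij => ?_, ?_⟩
  · rw [himage, himage]
    exact (hdisj i j hij).image hf.injOn (fun x hx => hx.1) fun x hx => hx.1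
  · simp only [himage]
    rw [← Set.image_iUnion, hunion, hf.image_eq]

namespace LineColoring

theorem equidecomposable_ascending :
    Equidecomposable (FreeGroup (Fin 4)) (ascending ×ˢ {false} : Set (LineColoring × Bool))
      (ascending ×ˢ {true}) := by
  classical
  obtain ⟨e, he, hc⟩ := exists_bijective_crossAscending
  let f (x : LineColoring × Bool) : LineColoring × Bool :=
    (e ⟨normalize x.1, normalize_mem _⟩, true)
  have hf {w : LineColoring} (hw : w ∈ ascending) (b : Bool) : f (w, b) = ((e ⟨w, hw⟩).1, true) := by
    simp only [f, normalize_of_mem hw]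
  refine Equidecomposable.of_bijOn (f := f) ⟨?_, ?_, ?_⟩
    (Finset.univ.image (fun c : Fin 3 => FreeGroup.of c.castSucc) ∪
      Finset.univ.image (fun c : Fin 3 => FreeGroup.of (Fin.last 3) * FreeGroup.of c.castSucc)) ?_
  · rintro ⟨w, b⟩ ⟨hw, -⟩
    exact ⟨(e _).2, rfl⟩
  · rintro ⟨w, b⟩ ⟨hw, hb⟩ ⟨w', b'⟩ ⟨hw', hb'⟩ h
    rw [hf hw, hf hw', Prod.mk.injEq] at h
    have := he.1 (Subtype.ext h.1)
    simp_all
  · rintro ⟨w, b⟩ ⟨hw, hb⟩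
    obtain ⟨v, hv⟩ := he.2 ⟨w, hw⟩
    refine ⟨(v, false), ⟨v.2, rfl⟩, ?_⟩
    rw [hf v.2, Subtype.coe_eta, hv]
    simp_all
  · rintro ⟨w, b⟩ ⟨hw, hb⟩
    obtain rfl : b = false := hb
    obtain ⟨c, h, h'⟩ := hc ⟨w, hw⟩
    rw [hf hw, h', crossAscending]
    rcases normalize_eq_or (cross c w) with h'' | h''
    · refine ⟨FreeGroup.of c.castSucc, Finset.mem_union_left _ (by simp), ?_⟩
      simp [of_smul, gen_castSucc, bodd_step h, h'']
    · refine ⟨FreeGroup.of (Fin.last 3) * FreeGroup.of c.castSucc,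
        Finset.mem_union_right _ (by simp), ?_⟩
      rw [mul_smul, of_smul, of_smul, gen_castSucc, gen_last]
      simp [bodd_step h, h'']

/-! ### Generic asymmetry and topological transitivity -/

theorem exists_forall_mem_of_isOpen {U : Set LineColoring} (hU : IsOpen U) {w : LineColoring}
    (hw : w ∈ U) : ∃ m : ℤ, 0 ≤ m ∧ ∀ v : LineColoring, (∀ k, |k| ≤ m → v.1 k = w.1 k) → v ∈ U := by
  obtain ⟨V, hV, rfl⟩ := isOpen_induced_iff.1 hU
  obtain ⟨I, u, hu, hI⟩ := isOpen_pi_iff.1 hV w.1 hw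
  refine ⟨(I.sup Int.natAbs : ℕ), by positivity, fun v hv => hI fun k hk => ?_⟩
  rw [hv k]
  · exact (hu k hk).2
  · have := Finset.le_sup (f := Int.natAbs) hk
    rw [Int.abs_eq_natAbs]
    exact_mod_cast this

theorem exists_color_ne (a b : Fin 3) : ∃ q, q ≠ a ∧ q ≠ b := by
  revert a b; decide

theorem exists_eq_of_lt_and_ne (w : LineColoring) (j : ℤ) :
    ∃ v : LineColoring, (∀ k < j, v.1 k = w.1 k) ∧ v.1 j ≠ w.1 j := by
  obtain ⟨q, hq, hq'⟩ := exists_color_ne (w.1 (j - 1)) (w.1 j)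
  -- From `j` on, `q` alternates with the color of edge `j - 1`.
  refine ⟨⟨fun k => if k < j then w.1 k else if Even (k - j) then q else w.1 (j - 1), fun k => ?_⟩,
    fun k hk => if_pos hk, by simpa using hq'⟩
  rcases lt_trichotomy (k + 1) j with h | h | h
  · simpa [h, (by omega : k < j)] using w.2 k
  · obtain rfl : k = j - 1 := by omega
    simpa using hq.symm
  · have h₁ : Even (k + 1 - j) ↔ ¬ Even (k - j) := by grind
    grind

/-- Beyond the window of a basic open set, color `j` can be changed while color `i`, at its left, is
kept. -/
theorem dense_compl_of_forall_exists_eq {C : Set LineColoring}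
    (hC : ∀ m : ℤ, ∃ j > m, ∃ i < j, ∀ w ∈ C, w.1 j = w.1 i) : Dense Cᶜ := by
  refine dense_iff_inter_open.2 fun U hU ⟨w, hw⟩ => ?_
  obtain ⟨m, -, hm⟩ := exists_forall_mem_of_isOpen hU hw
  obtain ⟨j, hj, i, hi, h⟩ := hC m
  obtain ⟨v, hv, hvj⟩ := exists_eq_of_lt_and_ne w j
  by_cases hwC : w ∈ C
  · refine ⟨v, hm v fun k hk => hv k ?_, fun hvC => hvj ?_⟩
    · have := le_abs_self k
      omega
    · rw [h v hvC, hv i hi, h w hwC]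
  · exact ⟨w, hw, hwC⟩

/-- A coloring is asymmetric if it is invariant under no nontrivial automorphism of the line. -/
def Asymmetric (w : LineColoring) : Prop :=
  (∀ k ≠ 0, shift k w ≠ w) ∧ ∀ k, shift k w ≠ flip w

theorem eventually_asymmetric : ∀ᶠ w in residual LineColoring, Asymmetric w := by
  refine Filter.Eventually.and ?_ ?_
  · simp only [eventually_countable_forall]
    intro k hk
    refine residual_of_dense_open (isClosed_eq (continuous_shift k) continuous_id).isOpen_compl
      (dense_compl_of_forall_exists_eq fun m => ?_)
    rcases hk.lt_or_gt with h | h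
    · refine ⟨m + 1, by omega, m + 1 + k, by omega, fun w hw => ?_⟩
      exact (congrFun (congrArg Subtype.val hw) (m + 1)).symm
    · refine ⟨m + 1 + k, by omega, m + 1, by omega, fun w hw => ?_⟩
      exact congrFun (congrArg Subtype.val hw) (m + 1)
  · simp only [eventually_countable_forall]
    intro k
    refine residual_of_dense_open (isClosed_eq (continuous_shift k) continuous_flip).isOpen_compl
      (dense_compl_of_forall_exists_eq fun m => ?_)
    refine ⟨|m| + |k| + 1, by have := le_abs_self m; have := abs_nonneg k; omega,
      -1 - (|m| + |k| + 1 - k),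
      by have := le_abs_self k; have := abs_nonneg k; have := abs_nonneg m; omega, fun w hw => ?_⟩
    simpa using congrFun (congrArg Subtype.val hw) (|m| + |k| + 1 - k)

theorem Asymmetric.eq_of_normalize_shift_eq {w : LineColoring} (hw : Asymmetric w) {k l : ℤ}
    (h : normalize (shift k w) = normalize (shift l w)) : k = l := by
  rcases eq_or_eq_flip_of_normalize_eq h with h | h
  · by_contra hkl
    refine hw.1 (-l + k) (by omega) ?_
    rw [← shift_shift, h]
    simp
  · refine absurd ?_ (hw.2 (l + k))
    rw [← shift_shift, h, shift_flip, shift_shift]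
    simp

theorem exists_shift_mem {U V : Set LineColoring} (hU : IsOpen U) (hV : IsOpen V)
    (hU' : U.Nonempty) (hV' : V.Nonempty) : ∃ (m : ℤ) (w : LineColoring),
      w ∈ U ∧ shift (2 * m) w ∈ V := by
  obtain ⟨u, hu⟩ := hU'
  obtain ⟨v, hv⟩ := hV'
  obtain ⟨a, ha, hua⟩ := exists_forall_mem_of_isOpen hU hu
  obtain ⟨b, hb, hvb⟩ := exists_forall_mem_of_isOpen hV hv
  obtain ⟨m, hma, hmb⟩ : ∃ m : ℤ, a ≤ m ∧ b ≤ m := ⟨max a b, by simp⟩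
  obtain ⟨q, hq, hq'⟩ := exists_color_ne (u.1 m) (v.1 (-m))
  -- Two windows of `2 * m + 1` edges are joined by one edge of color `q`; this makes the shift
  -- even.
  refine ⟨m + 1, ⟨fun k => if k ≤ m then u.1 k else if k = m + 1 then q
    else v.1 (k - 2 * (m + 1)), fun k => ?_⟩, hua _ fun k hk => if_pos ?_, hvb _ fun k hk => ?_⟩
  · rcases lt_trichotomy k m with h | rfl | h
    · simpa [h.le, (by omega : k + 1 ≤ m)] using u.2 k
    · simpa using hq.symm
    · rcases (by omega : k = m + 1 ∨ m + 1 < k) with rfl | h'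
      · have : v.1 (m + 1 + 1 - 2 * (m + 1)) = v.1 (-m) := by ring_nf
        grind
      · have := v.2 (k - 2 * (m + 1))
        rw [show k - 2 * (m + 1) + 1 = k + 1 - 2 * (m + 1) by ring] at this
        grind
  · have := le_abs_self k
    omega
  · have := neg_abs_le k
    have h₁ : ¬ k + 2 * (m + 1) ≤ m := by omega
    have h₂ : ¬ k + 2 * (m + 1) = m + 1 := by omega
    rw [shift_apply]
    simp only [if_neg h₁, if_neg h₂, add_sub_cancel_right]

/-! ### From equidecompositions to odd matchings -/

/-- The function `n` describes the displacement of the vertex `0` by the action of `γ`. -/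
structure IsDisplacement (γ : FreeGroup (Fin 4)) (n : LineColoring → ℤ) : Prop where
  continuous : Continuous n
  bounded : ∃ N, ∀ w, |n w| ≤ N
  flip : ∀ w, n (LineColoring.flip w) = -n w
  smul_snd : ∀ (w : LineColoring) (b : Bool), (γ • (w, b)).2 = xor b (n w).bodd
  normalize_smul_fst : ∀ (w : LineColoring) (b : Bool), normalize (γ • (w, b)).1 = normalize (shift (n w) w)

theorem abs_step_le (c : Fin 3) (w : LineColoring) : |step c w| ≤ 1 := by
  unfold step; split_ifs <;> simp

theorem exists_isDisplacement (γ : FreeGroup (Fin 4)) : ∃ n, IsDisplacement γ n := by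
  have key (i : Fin 4) : ∃ n : LineColoring → ℤ, Continuous n ∧ (∃ N, ∀ w, |n w| ≤ N) ∧
      (∀ w, n (LineColoring.flip w) = -n w) ∧ ∀ w b, (gen i (w, b)).2 = xor b (n w).bodd ∧
        normalize (gen i (w, b)).1 = normalize (shift (n w) w) := by
    induction i using Fin.lastCases with
    | last =>
      refine ⟨fun _ => 0, continuous_const, ⟨0, by simp⟩, by simp, fun w b => ?_⟩
      simp only [gen_last]
      simp [normalize_flip]
    | cast c =>
      refine ⟨step c, continuous_step c, ⟨1, abs_step_le c⟩, step_flip c, fun w b => ?_⟩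
      simp only [gen_castSucc]
      exact ⟨trivial, rfl⟩
  induction γ using FreeGroup.induction_on with
  | C1 => exact ⟨fun _ => 0, continuous_const, ⟨0, by simp⟩, by simp, by simp, by simp⟩
  | of i =>
    obtain ⟨n, h₁, h₂, h₃, h₄⟩ := key i
    exact ⟨n, h₁, h₂, h₃, fun w b => by rw [of_smul, (h₄ w b).1],
      fun w b => by rw [of_smul, (h₄ w b).2]⟩
  | inv_of i _ =>
    obtain ⟨n, h₁, h₂, h₃, h₄⟩ := key i
    exact ⟨n, h₁, h₂, h₃, fun w b => by rw [of_inv_smul, (h₄ w b).1],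
      fun w b => by rw [of_inv_smul, (h₄ w b).2]⟩
  | mul γ δ hγ hδ =>
    obtain ⟨m, hm⟩ := hγ
    obtain ⟨n, hn⟩ := hδ
    have hsmul (w : LineColoring) (b : Bool) :
        (δ • (w, b)) = (shift (n w) w, xor b (n w).bodd) ∨
          (δ • (w, b)) = (LineColoring.flip (shift (n w) w), xor b (n w).bodd) :=
      (eq_or_eq_flip_of_normalize_eq (hn.normalize_smul_fst w b)).imp
        (fun h => Prod.ext h (hn.smul_snd w b)) fun h => Prod.ext h (hn.smul_snd w b)
    -- Displacements add up along the orbit; if `δ` also reverses the line, the sign rule under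
    -- `flip` compensates.
    refine ⟨fun w => m (shift (n w) w) + n w,
      (hm.continuous.comp (continuous_shift_comp hn.continuous)).add hn.continuous, ?_,
      fun w => ?_, fun w b => ?_, fun w b => ?_⟩
    · obtain ⟨M, hM⟩ := hm.bounded
      obtain ⟨N, hN⟩ := hn.bounded
      exact ⟨M + N, fun w => (abs_add_le _ _).trans (add_le_add (hM _) (hN w))⟩
    · rw [hn.flip, ← flip_shift, hm.flip]
      ring
    · rw [mul_smul, Int.bodd_add]
      rcases hsmul w b with h | h <;> rw [h, hm.smul_snd]
      · simp [Bool.xor_comm]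
      · simp [hm.flip, Int.bodd_neg, Bool.xor_comm]
    · rw [mul_smul, ← shift_shift]
      rcases hsmul w b with h | h <;> rw [h, hm.normalize_smul_fst]
      rw [hm.flip, ← flip_shift, normalize_flip]

theorem IsDisplacement.normalize_smul_normalize {γ : FreeGroup (Fin 4)} {n : LineColoring → ℤ}
    (hn : IsDisplacement γ n) (w : LineColoring) (b : Bool) :
    normalize (γ • (normalize w, b)).1 = normalize (shift (n w) w) := by
  rw [hn.normalize_smul_fst]
  rcases normalize_eq_or w with h | h <;> rw [h]
  rw [hn.flip, ← flip_shift, normalize_flip]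

theorem IsDisplacement.smul_normalize_snd {γ : FreeGroup (Fin 4)} {n : LineColoring → ℤ}
    (hn : IsDisplacement γ n) (w : LineColoring) (b : Bool) :
    (γ • (normalize w, b)).2 = xor b (n w).bodd := by
  rw [hn.smul_snd]
  rcases normalize_eq_or w with h | h <;> rw [h]
  rw [hn.flip, Int.bodd_neg]

/-- A bounded function `n`, with the Baire property and not depending on the orientation of the
line, such that moving each `w` by `n w` is a bijection from the colorings up to orientation to
the colorings up to orientation, by odd displacements. -/
structure IsOddMatching (n : LineColoring → ℤ) : Prop where
  baireMeasurableSet : ∀ j, BaireMeasurableSet {w | n w = j}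
  bounded : ∃ N, ∀ w, |n w| ≤ N
  flip : ∀ w, n (LineColoring.flip w) = -n w
  odd : ∀ w, Odd (n w)
  injective : ∀ v w, normalize (shift (n v) v) = normalize (shift (n w) w) →
    normalize v = normalize w
  surjective : ∀ u, ∃ v, normalize (shift (n v) v) = normalize u

theorem odd_of_bodd {n : ℤ} (h : n.bodd = true) : Odd n := by
  have := Int.bodd_add_div2 n
  rw [h] at this
  exact ⟨n.div2, by simp at this; omega⟩

theorem baireMeasurableSet_setOf_normalize {P : Set (LineColoring × Bool)}
    (hP : BaireMeasurableSet P) : BaireMeasurableSet {w | (normalize w, false) ∈ P} := by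
  have h₁ : BaireMeasurableSet {w : LineColoring | (w, false) ∈ P} :=
    hP.preimage (f := fun w : LineColoring => (w, false)) (by fun_prop)
      fun U hU => by
        rw [show (fun w : LineColoring => (w, false)) '' U = U ×ˢ {false} by ext; aesop]
        exact hU.prod (isOpen_discrete _)
  have h₂ : BaireMeasurableSet {w : LineColoring | (LineColoring.flip w, false) ∈ P} :=
    h₁.preimage continuous_flip flipHomeomorph.isOpenMap
  have h₃ := isClopen_ascending.isOpen.baireMeasurableSet
  convert (h₁.inter h₃).union (h₂.inter h₃.compl) using 1
  ext w
  by_cases h : w ∈ ascending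
  · simp [normalize_of_mem h, h]
  · simp [normalize_of_notMem h, h]

theorem exists_isOddMatching
    (h : EquidecomposableUsing (FreeGroup (Fin 4)) BaireMeasurableSet
      (ascending ×ˢ {false} : Set (LineColoring × Bool)) (ascending ×ˢ {true})) :
    ∃ n, IsOddMatching n := by
  obtain ⟨k, P, γ, hP, hdisj, hunion, hdisj', hunion'⟩ := h
  choose d hd using fun i => exists_isDisplacement (γ i)
  have hmem (w : LineColoring) : ∃ i, (normalize w, false) ∈ P i := by
    rw [← Set.mem_iUnion, hunion]
    exact ⟨normalize_mem w, rfl⟩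
  choose ι hι using hmem
  have hι_eq {w : LineColoring} {i : Fin k} (hw : (normalize w, false) ∈ P i) : ι w = i := by
    by_contra hne
    exact Set.disjoint_left.1 (hdisj _ _ hne) (hι w) hw
  have hsmul (w : LineColoring) :
      γ (ι w) • (normalize w, false) = (normalize (shift (d (ι w) w) w), true) := by
    have hB : γ (ι w) • (normalize w, false) ∈
        (ascending ×ˢ {true} : Set (LineColoring × Bool)) := by
      rw [← hunion']
      exact Set.mem_iUnion.2 ⟨ι w, _, hι w, rfl⟩
    refine Prod.ext ?_ hB.2
    rw [← (hd _).normalize_smul_normalize w false, normalize_of_mem hB.1]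
  refine ⟨fun w => d (ι w) w, fun j => ?_, ?_, fun w => ?_, fun w => ?_, fun v w h => ?_,
    fun u => ?_⟩
  · convert BaireMeasurableSet.iUnion fun i =>
      (baireMeasurableSet_setOf_normalize (hP i)).inter
        ((isOpen_discrete {j}).preimage (hd i).continuous).baireMeasurableSet using 1
    ext w
    simp only [Set.mem_iUnion]
    refine ⟨fun h => ⟨ι w, hι w, h⟩, ?_⟩
    rintro ⟨i, h, h'⟩
    obtain rfl := hι_eq h
    exact h'
  · choose N hN using fun i => (hd i).bounded
    exact ⟨∑ i, |N i|, fun w => (hN _ w).trans ((le_abs_self _).trans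
      (Finset.single_le_sum (fun i _ => abs_nonneg (N i)) (Finset.mem_univ _)))⟩
  · rw [hι_eq (w := LineColoring.flip w) (by rw [normalize_flip]; exact hι w), (hd _).flip]
  · refine odd_of_bodd ?_
    have := (hd (ι w)).smul_normalize_snd w false
    rw [hsmul] at this
    simpa using this.symm
  · have heq : γ (ι v) • (normalize v, false) = γ (ι w) • (normalize w, false) := by
      rw [hsmul, hsmul, h]
    by_cases hvw : ι v = ι w
    · rw [hvw, smul_left_cancel_iff, Prod.mk.injEq] at heq
      exact heq.1
    · exact absurd heq fun heq => Set.disjoint_left.1 (hdisj' _ _ hvw) ⟨_, hι v, rfl⟩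
        ⟨_, hι w, heq.symm⟩
  · have hu : (normalize u, true) ∈ ⋃ i, (fun x => γ i • x) '' P i := by
      rw [hunion']
      exact ⟨normalize_mem u, rfl⟩
    obtain ⟨i, ⟨v, b⟩, hv, h⟩ := Set.mem_iUnion.1 hu
    have hvA : (v, b) ∈ (ascending ×ˢ {false} : Set (LineColoring × Bool)) := by
      rw [← hunion]
      exact Set.mem_iUnion.2 ⟨i, hv⟩
    obtain ⟨hv', rfl : b = false⟩ := hvA
    rw [← normalize_of_mem (w := v) hv'] at hv h
    obtain rfl := hι_eq hv
    refine ⟨v, ?_⟩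
    have := (hsmul v).symm.trans h
    exact (Prod.mk.inj this).1

/-! ### The flow of even vertices -/

/-- The contribution of an even vertex `k` to the flow across the edge at the left of `p`. -/
noncomputable def flowTerm (p k j : ℤ) : ℤ :=
  if Even k then (if k < p then 1 else 0) - (if j < p then 1 else 0) else 0

/-- The net number of even vertices that are moved across the edge at the left of `p`. -/
noncomputable def flow (n : LineColoring → ℤ) (p : ℤ) (w : LineColoring) : ℤ :=
  ∑ᶠ k, flowTerm p k (k + n (shift k w))

theorem flow_shift (n : LineColoring → ℤ) {j : ℤ} (hj : Even j) (w : LineColoring) :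
    flow n 0 (shift j w) = flow n j w := by
  unfold flow
  rw [← finsum_comp_equiv (Equiv.addRight j) (f := fun k => flowTerm j k (k + n (shift k w)))]
  refine finsum_congr fun k => ?_
  simp only [Equiv.coe_addRight, shift_shift, flowTerm, Int.even_add, hj, iff_true]
  grind

namespace IsOddMatching

variable {n : LineColoring → ℤ}

/-- Reflection in vertex `0` preserves parity, reverses directions and exchanges the two edges at
`0`. -/
theorem flow_flip (hn : IsOddMatching n) (w : LineColoring) :
    flow n 0 (LineColoring.flip w) = -flow n 1 w := by
  unfold flow
  rw [← finsum_neg_distrib,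
    ← finsum_comp_equiv (Equiv.neg ℤ) (f := fun k => -flowTerm 1 k (k + n (shift k w)))]
  refine finsum_congr fun k => ?_
  simp only [Equiv.neg_apply, shift_flip, hn.flip, flowTerm, even_neg]
  grind

theorem exists_support_subset (hn : IsOddMatching n) : ∃ N, ∀ p w,
    (Function.support fun k => flowTerm p k (k + n (shift k w))) ⊆
      Finset.Icc (p - N) (p + N) := by
  obtain ⟨N, hN⟩ := hn.bounded
  refine ⟨N, fun p w k hk => ?_⟩
  have := abs_le.1 (hN (shift k w))
  rw [Function.mem_support, flowTerm] at hk
  rw [Finset.coe_Icc, Set.mem_Icc]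
  by_contra h
  apply hk
  grind

theorem flow_add_one_sub (hn : IsOddMatching n) (p : ℤ) (w : LineColoring) :
    flow n (p + 1) w - flow n p w =
      ∑ᶠ k, if Even k then (if k = p then 1 else 0) - (if k + n (shift k w) = p then 1 else 0)
        else 0 := by
  obtain ⟨N, hN⟩ := hn.exists_support_subset
  unfold flow
  rw [← finsum_sub_distrib ((Finset.finite_toSet _).subset (hN _ _))
    ((Finset.finite_toSet _).subset (hN _ _))]
  refine finsum_congr fun k => ?_
  unfold flowTerm
  grind

/-- Displacements are odd, so no even vertex lands on `p`, while `p` itself departs. -/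
theorem flow_add_one_of_even (hn : IsOddMatching n) {p : ℤ} (hp : Even p) (w : LineColoring) :
    flow n (p + 1) w = flow n p w + 1 := by
  have h := hn.flow_add_one_sub p w
  rw [finsum_eq_single _ p] at h
  · have := hn.odd (shift p w)
    grind
  · intro k hk
    have := hn.odd (shift k w)
    grind

theorem eq_of_add_eq (hn : IsOddMatching n) {w : LineColoring} (hw : Asymmetric w) {k l : ℤ}
    (h : k + n (shift k w) = l + n (shift l w)) : k = l := by
  refine hw.eq_of_normalize_shift_eq (hn.injective _ _ ?_)
  rw [shift_shift, shift_shift, add_comm, h, add_comm]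

theorem exists_add_eq (hn : IsOddMatching n) (w : LineColoring) (p : ℤ) :
    ∃ k, k + n (shift k w) = p := by
  obtain ⟨v, hv⟩ := hn.surjective (shift p w)
  rcases eq_or_eq_flip_of_normalize_eq hv with h | h
  · refine ⟨-n v + p, ?_⟩
    rw [← shift_shift, ← h]
    simp
  · refine ⟨n v + p, ?_⟩
    rw [← shift_shift, ← flip_flip (shift p w), ← h, shift_flip, shift_shift, hn.flip]
    simp

/-- Exactly one vertex lands on `p`, and it is even; asymmetry gives its uniqueness. -/
theorem flow_add_one_of_odd (hn : IsOddMatching n) {w : LineColoring} (hw : Asymmetric w) {p : ℤ}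
    (hp : Odd p) : flow n (p + 1) w = flow n p w - 1 := by
  have h := hn.flow_add_one_sub p w
  obtain ⟨k, hk⟩ := hn.exists_add_eq w p
  rw [finsum_eq_single _ k] at h
  · have := hn.odd (shift k w)
    grind
  · intro l hl
    have : l + n (shift l w) ≠ p := fun h => hl (hn.eq_of_add_eq hw (h.trans hk.symm))
    grind

theorem flow_two_mul (hn : IsOddMatching n) {w : LineColoring} (hw : Asymmetric w) (m : ℤ) :
    flow n (2 * m) w = flow n 0 w := by
  have h (m : ℤ) : flow n (2 * (m + 1)) w = flow n (2 * m) w := by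
    rw [show 2 * (m + 1) = 2 * m + 1 + 1 by ring, hn.flow_add_one_of_odd hw ⟨m, rfl⟩,
      hn.flow_add_one_of_even (even_two_mul m)]
    ring
  induction m using Int.induction_on with
  | zero => simp
  | succ i ih => rw [h, ih]
  | pred i ih => rw [← ih, ← h (-i - 1), sub_add_cancel]

theorem flow_flip_shift (hn : IsOddMatching n) {w : LineColoring} (hw : Asymmetric w) (m : ℤ) :
    flow n 0 (LineColoring.flip (shift (2 * m) w)) = -1 - flow n 0 w := by
  have h := hn.flow_add_one_of_even Even.zero (shift (2 * m) w)
  rw [flow_shift n (even_two_mul m), hn.flow_two_mul hw, zero_add] at h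
  rw [hn.flow_flip, h]
  ring

theorem baireMeasurableSet_flow_nonneg (hn : IsOddMatching n) :
    BaireMeasurableSet {w | 0 ≤ flow n 0 w} := by
  obtain ⟨N, hN⟩ := hn.exists_support_subset
  -- The measurable sets are now those with the Baire property.
  let _ : MeasurableSpace LineColoring := eventuallyMeasurableSpace (borel _) (residual _)
  have hm (k : ℤ) : Measurable fun w => n (shift k w) := measurable_to_countable' fun j =>
    (hn.baireMeasurableSet j).preimage (continuous_shift k) (shiftHomeomorph k).isOpenMap
  have hflow : Measurable (flow n 0) := by
    have : flow n 0 = fun w => ∑ k ∈ Finset.Icc (0 - N) (0 + N),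
        flowTerm 0 k (k + n (shift k w)) :=
      funext fun w => finsum_eq_sum_of_support_subset _ (hN 0 w)
    rw [this]
    exact Finset.measurable_sum _ fun k _ =>
      (measurable_of_countable fun j : ℤ => flowTerm 0 k (k + j)).comp (hm k)
  exact hflow measurableSet_Ici

end IsOddMatching

/-! ### The contradiction -/

instance : Nonempty LineColoring :=
  ⟨⟨fun k => if Even k then 0 else 1, fun k => by by_cases h : Even k <;> simp [h]⟩⟩

theorem not_isOddMatching (n : LineColoring → ℤ) : ¬ IsOddMatching n := by
  intro hn
  obtain ⟨U, hU, hSU⟩ := hn.baireMeasurableSet_flow_nonneg.residualEq_isOpen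
  -- On `O`, membership in `U` agrees at `w` and at its reflected even shift, whereas generically
  -- the flows `F` and `-1 - F` have opposite signs.
  obtain ⟨m, O, hO, hO', h⟩ : ∃ (m : ℤ) (O : Set LineColoring), IsOpen O ∧ O.Nonempty ∧
      ∀ w ∈ O, w ∈ U ↔ flip (shift (2 * m) w) ∈ U := by
    rcases U.eq_empty_or_nonempty with rfl | hU'
    · exact ⟨0, Set.univ, isOpen_univ, Set.univ_nonempty, by simp⟩
    · obtain ⟨m, w, hw, hw'⟩ := exists_shift_mem hU (hU.preimage continuous_flip) hU'
        (hU'.preimage flipHomeomorph.surjective)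
      exact ⟨m, U ∩ shift (2 * m) ⁻¹' (flip ⁻¹' U),
        hU.inter ((hU.preimage continuous_flip).preimage (continuous_shift _)), ⟨w, hw, hw'⟩,
        fun v hv => iff_of_true hv.1 hv.2⟩
  have hS : ∀ᶠ w in residual LineColoring, (0 ≤ flow n 0 w ↔ w ∈ U) :=
    Filter.eventuallyEq_set.1 hSU
  have hS' : ∀ᶠ w in residual LineColoring,
      (0 ≤ flow n 0 (flip (shift (2 * m) w)) ↔ flip (shift (2 * m) w) ∈ U) :=
    (tendsto_residual_of_isOpenMap (continuous_flip.comp (continuous_shift (2 * m)))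
      (flipHomeomorph.isOpenMap.comp (shiftHomeomorph (2 * m)).isOpenMap)).eventually hS
  obtain ⟨w, hwO, ⟨hw, hw'⟩, hwA⟩ := (dense_of_mem_residual
    ((hS.and hS').and eventually_asymmetric)).inter_open_nonempty O hO hO'
  rw [hn.flow_flip_shift hwA, ← h w hwO, ← hw] at hw'
  omega

end LineColoring

theorem mainTheorem4 :
    ∃ (n : ℕ) (X : Type) (_ : TopologicalSpace X) (_ : PolishSpace X)
      (_ : MeasurableSpace X) (_ : BorelSpace X) (_ : MulAction (FreeGroup (Fin n)) X)
      (B₀ B₁ : Set X),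
      ActsByBorelAutomorphisms (FreeGroup (Fin n)) X ∧
      MeasurableSet B₀ ∧ MeasurableSet B₁ ∧
      Equidecomposable (FreeGroup (Fin n)) B₀ B₁ ∧
      ¬ EquidecomposableUsing (FreeGroup (Fin n)) BaireMeasurableSet B₀ B₁ := by
  let _ : MeasurableSpace (LineColoring × Bool) := borel _
  have : BorelSpace (LineColoring × Bool) := ⟨rfl⟩
  have hopen (b : Bool) :
      IsOpen (LineColoring.ascending ×ˢ {b} : Set (LineColoring × Bool)) :=
    LineColoring.isClopen_ascending.isOpen.prod (isOpen_discrete _)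
  have : PolishSpace (LineColoring × Bool) := inferInstance
  refine ⟨4, LineColoring × Bool, inferInstance, inferInstance, inferInstance, inferInstance,
    inferInstance, LineColoring.ascending ×ˢ {false}, LineColoring.ascending ×ˢ {true},
    fun γ => (LineColoring.continuous_smul_freeGroup γ).measurable, (hopen _).measurableSet,
    (hopen _).measurableSet, LineColoring.equidecomposable_ascending, fun h => ?_⟩
  obtain ⟨n, hn⟩ := LineColoring.exists_isOddMatching h
  exact LineColoring.not_isOddMatching n hn
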